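/- Let $K\ge 1$ and let $(\alpha_m)_{m\ge0}$ be a real $K$-periodic sequence, $\alpha_{m+K}=\alpha_m$. Let $p_{-1}=0$, $p_0=1$, $p_{m+1}(t)=(t-\alpha_m)p_m(t)-p_{m-1}(t)$ for $m\ge0$, and let $\varphi$ be an orthogonality measure of $(p_m)_{m\ge0}$, that is, a nonzero Borel measure on $\mathbb R$ with finite moments and $\int p_mp_n\,d\varphi=0$ for $m\ne n$. Define polynomials $a_\ell,b_\ell$ by $a_{-1}=1$, $a_0(t)=t-\alpha_0$, $b_{-1}=0$, $b_0=1$, $a_{\ell+1}(t)=(t-\alpha_{\ell+1})a_\ell(t)-a_{\ell-1}(t)$ and $b_{\ell+1}(t)=(t-\alpha_{\ell+1})b_\ell(t)-b_{\ell-1}(t)$, and put $q_0=p_{K-1}$ and $T=a_{K-1}-b_{K-2}$ (a monic polynomial of degree $K$). Let $\xi_1<\dots<\xi_s$ be all the real local minima and maxima of $T$, and put $\xi_0=-\infty$, $\xi_{s+1}=\infty$. Then $T$ is strictly monotone on each interval $J_j=[\xi_j,\xi_{j+1}]\cap\mathbb R$, $0\le j\le s$. Let $\nu_1<\dots<\nu_r$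 be all the indices $j$ for which $T(J_j)\supseteq[-2,2]$. For each $\ell=1,\dots,r$ there is a unique nondegenerate compact interval $I_\ell=[c_\ell,d_\ell]\subseteq J_{\nu_\ell}$ such that $|T|=2$ at both of its endpoints; the interiors of $I_1,\dots,I_r$ are pairwise disjoint. With $\Xi=I_1\cup\dots\cup I_r$: 1. $\Xi$ is the essential support of $\varphi$, i.e. the set of accumulation points of the support of $\varphi$; moreover, the part of $\varphi$ outside $\Xi$ is carried by the finitely many zeros of $q_0$ outside $\Xi$. 2. The measure $d\psi=q_0^2\,d\varphi$ satisfies $\psi(\mathbb R\setminus\Xi)=0$ and is a pull-back of the Chebyshev measure of the second kind through $\frac12T$, in the following sense: if $X_\ell:[-1,1]\to I_\ell$ denotes the inverse of $\frac12T|_{I_\ell}$, then $$\sum_{\ell=1}^r\psi(X_\ell(A))=\varphi(\mathbb R)\,\frac2\pi\int_A\sqrt{1-x^2}\,dx\qquad\text{for every Borel set }A\subseteq[-1,1].$$ -/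

import Mathlib

open MeasureTheory Polynomial Set

noncomputable section

/-- The monic polynomials `p_m` given by `p_{-1} = 0`, `p_0 = 1`,
`p_{m+1}(t) = (t - α_m) p_m(t) - p_{m-1}(t)`. -/
def orthPoly (α : ℕ → ℝ) : ℕ → ℝ[X]
  | 0 => 1
  | 1 => X - C (α 0)
  | m + 2 => (X - C (α (m + 1))) * orthPoly α (m + 1) - orthPoly α m

/-- `aPoly α i` is the polynomial `a_{i-1}`, where `a_{-1} = 1`, `a_0(t) = t - α_0` and
`a_{l+1}(t) = (t - α_{l+1}) a_l(t) - a_{l-1}(t)`. -/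
def aPoly (α : ℕ → ℝ) : ℕ → ℝ[X]
  | 0 => 1
  | 1 => X - C (α 0)
  | i + 2 => (X - C (α (i + 1))) * aPoly α (i + 1) - aPoly α i

/-- `bPoly α i` is the polynomial `b_{i-1}`, where `b_{-1} = 0`, `b_0 = 1` and
`b_{l+1}(t) = (t - α_{l+1}) b_l(t) - b_{l-1}(t)`. -/
def bPoly (α : ℕ → ℝ) : ℕ → ℝ[X]
  | 0 => 0
  | 1 => 1
  | i + 2 => (X - C (α (i + 1))) * bPoly α (i + 1) - bPoly α i

/-- The polynomial `T = a_{K-1} - b_{K-2}` of degree `K`, which is the coefficient in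
`q_{n+1} = T q_n - q_{n-1}` for `q_n = p_{(n+1)K-1}` (meant for `1 ≤ K`). -/
def periodPoly (α : ℕ → ℝ) (K : ℕ) : ℝ[X] :=
  aPoly α K - bPoly α (K - 1)

/-- `φ` is an orthogonality measure of the polynomial sequence `p`: a nonzero Borel measure on the
line with finite moments of every order, with respect to which distinct `p_m`, `p_n` are
orthogonal. -/
structure IsOrthogonalityMeasure (p : ℕ → ℝ[X]) (φ : Measure ℝ) : Prop where
  ne_zero : φ ≠ 0
  integrable_pow : ∀ n : ℕ, Integrable (fun t : ℝ => t ^ n) φ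
  orthogonal : ∀ m n : ℕ, m ≠ n → ∫ t, (p m).eval t * (p n).eval t ∂φ = 0

/-- The essential support: the points every neighbourhood of which contains infinitely many
points of the (closed) support. -/
def essentialSupport (φ : Measure ℝ) : Set ℝ :=
  {t | ∀ U ∈ nhds t, (U ∩ φ.support).Infinite}

/-- `-∞ = ξ_0 < ξ_1 < ⋯ < ξ_s < ξ_{s+1} = ∞`, where `ξ_1, …, ξ_s` are exactly the real local
minima and maxima of `P`. -/
structure IsTurningSequence (P : ℝ[X]) (s : ℕ) (ξ : Fin (s + 2) → EReal) : Prop where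
  strictMono : StrictMono ξ
  first : ξ 0 = ⊥
  last : ξ (Fin.last (s + 1)) = ⊤
  mem_range : ∀ t : ℝ, (t : EReal) ∈ range ξ ↔ IsLocalExtr (fun u => P.eval u) t

/-- The real interval `[ξ_j, ξ_{j+1}]`, for `j = 0, …, s`. -/
def turningInterval {s : ℕ} (ξ : Fin (s + 2) → EReal) (j : Fin (s + 1)) : Set ℝ :=
  {t : ℝ | ξ j.castSucc ≤ t ∧ (t : EReal) ≤ ξ j.succ}

/-- `[c, d]` is the unique nondegenerate compact interval inside `J` at both of whose endpoints
`|P| = 2`. -/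
def IsUniqueBand (P : ℝ[X]) (J : Set ℝ) (c d : ℝ) : Prop :=
  (c < d ∧ Icc c d ⊆ J ∧ |P.eval c| = 2 ∧ |P.eval d| = 2) ∧
    ∀ c' d' : ℝ, c' < d' → Icc c' d' ⊆ J → |P.eval c'| = 2 → |P.eval d'| = 2 →
      c' = c ∧ d' = d

/-- The normalized Chebyshev measure of the second kind, `(2/π) (1 - x^2)^{1/2} dx` on
`[-1, 1]`. -/
def chebyshevMeasure : Measure ℝ :=
  (volume.restrict (Icc (-1) 1)).withDensity
    (fun x => ENNReal.ofReal (2 / Real.pi * Real.sqrt (1 - x ^ 2)))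

end

/-! Running the recurrence through one period is a linear map with trace `T` and determinant 1, so
Cayley–Hamilton yields `q_{n+1} = T q_n - q_{n-1}` for `q_n = p_{(n+1)K-1}`. Since `q_{-1} = 0`,
this solves to `q_n = U_n(T/2) q_0` (`orthPoly_period_eq`); everything else follows from this
factorization.

Measure: all `p_m` have the same norm, so the integral of `q_n q_0` is `φ(ℝ)` for `n = 0` and 0
otherwise. Thus the image of `q_0² φ` under `T/2` has the `U_n`-moments of `φ(ℝ)` times the
Chebyshev measure. A compactly supported measure is determined by its moments, so the two agree
(`map_periodPoly_div_two`). Hence `q_0² φ` lives on `{|T| ≤ 2}` and has no atoms, and outside that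
set `φ` can only charge zeros of `q_0`.

Geometry: `T - l` divides `q_n` up to the factor `q_0` whenever `l` is a zero of `U_n(·/2)`, so it
has only real zeros. Laguerre's inequality then keeps local maxima of `T` at or above `l` and local
minima at or below it. Such `l` approach `±2`, so every monotonicity interval contains a full band
and the bands together fill `{|T| ≤ 2}`.

Support: where `|T| < 2` the values `p_m(t)` along multiples of the period stay bounded without
dying out, whereas a gap of `φ` around `t` would force exponential growth
(`mem_support_of_abs_lt_two`). The open bands therefore lie in the support. -/

/-- The sequence `0 = p_{-1}, p_0, p_1, …`. -/
noncomputable def shiftedOrthPoly (α : ℕ → ℝ) : ℕ → ℝ[X]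
  | 0 => 0
  | m + 1 => orthPoly α m

/-! ### Periodic recurrence and the Chebyshev factorization -/

theorem orthPoly_add_two (α : ℕ → ℝ) (m : ℕ) :
    orthPoly α (m + 2) = (X - C (α (m + 1))) * orthPoly α (m + 1) - orthPoly α m := by
  rw [orthPoly]

theorem aPoly_eq_orthPoly (α : ℕ → ℝ) (m : ℕ) : aPoly α m = orthPoly α m := by
  induction m using Nat.twoStepInduction with
  | zero => rfl
  | one => rfl
  | more m h₀ h₁ => rw [aPoly, orthPoly, h₀, h₁]

theorem shiftedOrthPoly_add_two (α : ℕ → ℝ) (m : ℕ) :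
    shiftedOrthPoly α (m + 2) =
      (X - C (α m)) * shiftedOrthPoly α (m + 1) - shiftedOrthPoly α m := by
  cases m with
  | zero => simp [shiftedOrthPoly, orthPoly]
  | succ m => exact orthPoly_add_two α m

/-- The solution of the recurrence with initial values `1, 0`. -/
noncomputable def secondSolution (α : ℕ → ℝ) : ℕ → ℝ[X]
  | 0 => 1
  | m + 1 => -bPoly α m

theorem secondSolution_add_two (α : ℕ → ℝ) (m : ℕ) :
    secondSolution α (m + 2) =
      (X - C (α m)) * secondSolution α (m + 1) - secondSolution α m := by
  cases m with
  | zero => simp [secondSolution, bPoly]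
  | succ m => simp only [secondSolution, bPoly]; ring

theorem solution_eq (α : ℕ → ℝ) (y : ℕ → ℝ[X])
    (hy : ∀ m, y (m + 2) = (X - C (α m)) * y (m + 1) - y m) (m : ℕ) :
    y m = y 0 * secondSolution α m + y 1 * shiftedOrthPoly α m := by
  induction m using Nat.twoStepInduction with
  | zero => simp [secondSolution, shiftedOrthPoly]
  | one => simp [secondSolution, shiftedOrthPoly, bPoly, orthPoly]
  | more m h₀ h₁ =>
    rw [hy, secondSolution_add_two, shiftedOrthPoly_add_two]
    linear_combination (X - C (α m)) * h₁ - h₀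

theorem wronskian_eq_one (α : ℕ → ℝ) (m : ℕ) :
    secondSolution α m * shiftedOrthPoly α (m + 1) -
      secondSolution α (m + 1) * shiftedOrthPoly α m = 1 := by
  induction m with
  | zero => simp [secondSolution, shiftedOrthPoly, orthPoly]
  | succ m ih =>
    rw [secondSolution_add_two, shiftedOrthPoly_add_two]
    linear_combination ih

/-- This exhibits `T` as the trace of the monodromy matrix in the basis of the two standard
solutions. -/
theorem periodPoly_eq {K : ℕ} (hK : 1 ≤ K) (α : ℕ → ℝ) :
    periodPoly α K = secondSolution α K + shiftedOrthPoly α (K + 1) := by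
  obtain ⟨k, rfl⟩ := Nat.exists_eq_add_of_le' hK
  simp only [periodPoly, aPoly_eq_orthPoly, secondSolution, shiftedOrthPoly,
    Nat.add_sub_cancel]
  ring

/-- Cayley–Hamilton for the monodromy matrix: its trace is `periodPoly α K`, and its determinant is
1 by `wronskian_eq_one`. Periodicity makes the second period apply the same matrix. -/
theorem solution_period {K : ℕ} (hK : 1 ≤ K) {α : ℕ → ℝ} (hα : ∀ m, α (m + K) = α m)
    (y : ℕ → ℝ[X]) (hy : ∀ m, y (m + 2) = (X - C (α m)) * y (m + 1) - y m) :
    y (2 * K) = periodPoly α K * y K - y 0 ∧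
      y (2 * K + 1) = periodPoly α K * y (K + 1) - y 1 := by
  have hz : ∀ m, (fun i => y (i + K)) (m + 2) =
      (X - C (α m)) * (fun i => y (i + K)) (m + 1) - (fun i => y (i + K)) m := by
    intro m
    have := hy (m + K)
    rw [hα] at this
    simpa only [add_right_comm _ _ K] using this
  have e := solution_eq α y hy
  have e' := solution_eq α (fun i => y (i + K)) hz
  have h1 := e K
  have h2 := e (K + 1)
  have h3 := e' K
  have h4 := e' (K + 1)
  simp only [zero_add] at h3 h4
  rw [add_comm 1 K, ← two_mul] at h3
  rw [add_comm 1 K, add_right_comm, ← two_mul] at h4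
  have w := wronskian_eq_one α K
  rw [periodPoly_eq hK, h3, h4]
  constructor
  · linear_combination shiftedOrthPoly α K * h2 - shiftedOrthPoly α (K + 1) * h1 - y 0 * w
  · linear_combination secondSolution α (K + 1) * h1 - secondSolution α K * h2 - y 1 * w

theorem shiftedOrthPoly_period {K : ℕ} (hK : 1 ≤ K) {α : ℕ → ℝ} (hα : ∀ m, α (m + K) = α m)
    (n i : ℕ) (hi : i < 2) :
    shiftedOrthPoly α ((n + 2) * K + i) =
      periodPoly α K * shiftedOrthPoly α ((n + 1) * K + i) - shiftedOrthPoly α (n * K + i) := by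
  have hper : ∀ n m, α (m + n * K) = α m := by
    intro n m
    induction n with
    | zero => simp
    | succ n ih => rw [Nat.succ_mul, ← add_assoc, hα, ih]
  have hz : ∀ m, (fun i => shiftedOrthPoly α (i + n * K)) (m + 2) =
      (X - C (α m)) * (fun i => shiftedOrthPoly α (i + n * K)) (m + 1) -
        (fun i => shiftedOrthPoly α (i + n * K)) m := by
    intro m
    have := shiftedOrthPoly_add_two α (m + n * K)
    rw [hper] at this
    simpa only [add_right_comm _ _ (n * K)] using this
  obtain ⟨h0, h1⟩ := solution_period hK hα (fun i => shiftedOrthPoly α (i + n * K)) hz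
  interval_cases i
  · rwa [show 2 * K + n * K = (n + 2) * K + 0 by ring, show K + n * K = (n + 1) * K + 0 by ring,
      show 0 + n * K = n * K + 0 by ring] at h0
  · rwa [show 2 * K + 1 + n * K = (n + 2) * K + 1 by ring,
      show K + 1 + n * K = (n + 1) * K + 1 by ring, add_comm 1] at h1

/-- Starting the shifted sequence at `p_{-1} = 0` is what makes the three-term recurrence in `n`
have exactly the initial data of `S_n(T) q_0`. -/
theorem orthPoly_period_eq {K : ℕ} (hK : 1 ≤ K) {α : ℕ → ℝ} (hα : ∀ m, α (m + K) = α m)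
    (n : ℕ) : orthPoly α ((n + 1) * K - 1) =
      (Chebyshev.S ℝ n).comp (periodPoly α K) * orthPoly α (K - 1) := by
  have key : ∀ n : ℕ, shiftedOrthPoly α ((n + 1) * K) =
      (Chebyshev.S ℝ n).comp (periodPoly α K) * shiftedOrthPoly α K := by
    intro n
    induction n using Nat.twoStepInduction with
    | zero => simp
    | one =>
      have := shiftedOrthPoly_period hK hα 0 0 (by norm_num)
      simpa [shiftedOrthPoly] using this
    | more n h₀ h₁ =>
      have := shiftedOrthPoly_period hK hα (n + 1) 0 (by norm_num)
      simp only [add_zero] at this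
      push_cast at h₁ ⊢
      rw [this, show n + 1 + 1 = n + 2 from rfl] 
      rw [show n + 1 + 1 = n + 2 from rfl] at h₁
      rw [h₁, h₀, Chebyshev.S_add_two]
      simp only [sub_comp, mul_comp, X_comp]
      ring
  have aux : ∀ j, 1 ≤ j → shiftedOrthPoly α j = orthPoly α (j - 1) := by
    intro j hj
    obtain ⟨k, rfl⟩ := Nat.exists_eq_add_of_le' hj
    rfl
  rw [← aux _ (Nat.le_trans hK (Nat.le_mul_of_pos_left K n.succ_pos)), ← aux K hK]
  exact key n

theorem orthPoly_monic_natDegree (α : ℕ → ℝ) (m : ℕ) :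
    (orthPoly α m).Monic ∧ (orthPoly α m).natDegree = m := by
  induction m using Nat.twoStepInduction with
  | zero => simp [orthPoly]
  | one => exact ⟨monic_X_sub_C _, natDegree_X_sub_C _⟩
  | more m h₀ h₁ =>
    have hM : ((X - C (α (m + 1))) * orthPoly α (m + 1)).Monic := (monic_X_sub_C _).mul h₁.1
    have hd : ((X - C (α (m + 1))) * orthPoly α (m + 1)).natDegree = m + 2 := by
      rw [(monic_X_sub_C _).natDegree_mul h₁.1, natDegree_X_sub_C, h₁.2]; ring
    have hlt : (orthPoly α m).degree < ((X - C (α (m + 1))) * orthPoly α (m + 1)).degree := by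
      rw [degree_eq_natDegree h₀.1.ne_zero, degree_eq_natDegree hM.ne_zero, hd, h₀.2]
      exact_mod_cast (by omega : m < m + 2)
    rw [orthPoly]
    refine ⟨hM.sub_of_left hlt, ?_⟩
    rw [natDegree_sub_eq_left_of_natDegree_lt (natDegree_lt_natDegree h₀.1.ne_zero hlt), hd]

theorem bPoly_degree_lt (α : ℕ → ℝ) (m : ℕ) : (bPoly α m).degree < m := by
  induction m using Nat.twoStepInduction with
  | zero => simp [bPoly]
  | one => simp [bPoly]
  | more m h₀ h₁ =>
    rw [bPoly]
    refine (degree_sub_le _ _).trans_lt (max_lt ?_ ?_)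
    · rw [degree_mul, degree_X_sub_C]
      calc 1 + (bPoly α (m + 1)).degree < 1 + ((m + 1 : ℕ) : WithBot ℕ) :=
            WithBot.add_lt_add_left (by simp) h₁
        _ = ((m + 2 : ℕ) : WithBot ℕ) := by push_cast; ring
    · exact h₀.trans (by exact_mod_cast (by omega : m < m + 2))

theorem periodPoly_natDegree (K : ℕ) (α : ℕ → ℝ) :
    (periodPoly α K).natDegree = K := by
  have h := orthPoly_monic_natDegree α K
  rw [periodPoly, aPoly_eq_orthPoly]
  have hlt : (bPoly α (K - 1)).degree < (orthPoly α K).degree := by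
    rw [degree_eq_natDegree h.1.ne_zero, h.2]
    exact (bPoly_degree_lt α _).trans_le (by exact_mod_cast Nat.sub_le K 1)
  rw [natDegree_eq_of_degree_eq (degree_sub_eq_left_of_degree_lt hlt), h.2]

/-! ### Real zeros, Laguerre's inequality and the extrema of `T` -/

theorem aeval_orthPoly_ne_zero (α : ℕ → ℝ) {z : ℂ} (hz : z.im ≠ 0) (m : ℕ) :
    aeval z (orthPoly α m) ≠ 0 := by
  set u : ℕ → ℂ := fun m => aeval z (orthPoly α m) with hu
  have hrec : ∀ m, u (m + 2) = (z - α (m + 1)) * u (m + 1) - u m := by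
    intro m
    simp [hu, orthPoly_add_two]
  have h0 : u 0 = 1 := by simp [hu, orthPoly]
  have h1 : u 1 = z - α 0 := by simp [hu, orthPoly]
  -- By the recurrence, passing from `m` to `m + 1` increases this quantity by `(z.im)²` times the
  -- squared modulus of `u (m + 1)`.
  have key : ∀ m, 0 < z.im * (u (m + 1) * (starRingEnd ℂ) (u m)).im := by
    intro m
    induction m with
    | zero => simp [h0, h1]; positivity
    | succ m ih =>
      rw [hrec]
      simp only [Complex.mul_im, Complex.sub_im, Complex.sub_re, Complex.mul_re, Complex.conj_re,
        Complex.conj_im, Complex.ofReal_im, Complex.ofReal_re] at ih ⊢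
      nlinarith [sq_nonneg (z.im * (u (m + 1)).re), sq_nonneg (z.im * (u (m + 1)).im)]
  cases m with
  | zero => simp [orthPoly]
  | succ m =>
    intro h
    have := key m
    rw [show u (m + 1) = 0 from h] at this
    simp at this

/-- For `P = (X - a) Q` one has `P'² - P P'' = Q² + (x - a)² (Q'² - Q Q'')`, which drives the
induction. -/
theorem multiset_prod_laguerre (s : Multiset ℝ) (x : ℝ) :
    0 ≤ (derivative (s.map fun a => X - C a).prod).eval x ^ 2 -
      (s.map fun a => X - C a).prod.eval x *
        (derivative (derivative (s.map fun a => X - C a).prod)).eval x := by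
  induction s using Multiset.induction_on with
  | empty => simp
  | cons a s ih =>
    set Q := (s.map fun a => X - C a).prod
    simp only [Multiset.map_cons, Multiset.prod_cons, derivative_mul, derivative_sub, derivative_X,
      derivative_C, sub_zero, one_mul, derivative_add, eval_add, eval_mul, eval_sub, eval_X, eval_C]
    nlinarith [sq_nonneg (Q.eval x), mul_nonneg (sq_nonneg (x - a)) ih]

/-- Laguerre's inequality. -/
theorem laguerre_inequality {P : ℝ[X]} (hs : P.Splits) (hd : 0 < P.natDegree) {x : ℝ}
    (hx : P.eval x ≠ 0) :
    0 < (derivative P).eval x ^ 2 - P.eval x * (derivative (derivative P)).eval x := by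
  have hP : P ≠ 0 := by rintro rfl; simp at hd
  have hc : P.leadingCoeff ≠ 0 := leadingCoeff_ne_zero.mpr hP
  have hne : P.roots ≠ 0 := by
    intro h
    have := splits_iff_card_roots.mp hs
    rw [h] at this
    simp at this
    omega
  -- Splitting off one root leaves the term `Q(x)²`, which is positive and makes the inequality
  -- strict.
  obtain ⟨a, s, hr⟩ : ∃ a s, P.roots = a ::ₘ s := by
    obtain ⟨a, ha⟩ := Multiset.exists_mem_of_ne_zero hne
    exact ⟨a, _, (Multiset.cons_erase ha).symm⟩
  have e := hs.eq_prod_roots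
  rw [hr, Multiset.map_cons, Multiset.prod_cons] at e
  have hl := multiset_prod_laguerre s x
  set Q := (s.map fun a => X - C a).prod
  have e0 : P.eval x = P.leadingCoeff * ((x - a) * Q.eval x) := by
    conv_lhs => rw [e]
    simp
  have hQ : Q.eval x ≠ 0 := by
    intro h
    rw [e0, h] at hx
    simp at hx
  have e1 : (derivative P).eval x =
      P.leadingCoeff * (Q.eval x + (x - a) * (derivative Q).eval x) := by
    conv_lhs => rw [e]
    simp [derivative_mul]
  have e2 : (derivative (derivative P)).eval x = P.leadingCoeff *
      (2 * (derivative Q).eval x + (x - a) * (derivative (derivative Q)).eval x) := by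
    conv_lhs => rw [e]
    simp [derivative_mul]
    exact Or.inl (by ring)
  rw [e0, e1, e2]
  have : 0 < P.leadingCoeff ^ 2 * (Q.eval x ^ 2 + (x - a) ^ 2 *
      ((derivative Q).eval x ^ 2 - Q.eval x * (derivative (derivative Q)).eval x)) := by
    have h1 : 0 < Q.eval x ^ 2 := by positivity
    have h2 := mul_nonneg (sq_nonneg (x - a)) hl
    positivity
  linarith

theorem splits_of_forall_im_eq_zero {P : ℝ[X]} (h : ∀ z : ℂ, aeval z P = 0 → z.im = 0) :
    P.Splits := by
  by_cases hP : P = 0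
  · simp [hP]
  refine Splits.of_splits_map (algebraMap ℝ ℂ) (IsAlgClosed.splits _) fun z hz => ?_
  have hz' := h z (by
    have := (mem_roots (map_ne_zero hP)).mp hz
    rwa [IsRoot, eval_map_algebraMap] at this)
  exact ⟨z.re, Complex.ext rfl (by simp [hz'])⟩

theorem isLocalExtr_derivative_eval {P : ℝ[X]} {x : ℝ}
    (h : IsLocalExtr (fun u => P.eval u) x) : (derivative P).eval x = 0 := by
  have := h.deriv_eq_zero
  rwa [Polynomial.deriv] at this

theorem Polynomial.not_eventually_const {P : ℝ[X]} (hd : 0 < P.natDegree) (x c : ℝ) :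
    ¬ ∀ᶠ t in nhds x, P.eval t = c := by
  intro h
  have hinf : {t | P.eval t = c}.Infinite := infinite_of_mem_nhds x h
  have hne : P - C c ≠ 0 := by
    intro h0
    rw [sub_eq_zero.mp h0] at hd
    simp at hd
  refine hinf ((P - C c).roots.toFinset.finite_toSet.subset fun t ht => ?_)
  have ht' : P.eval t = c := ht
  simp [hne, ht']

/-- If `P - λ` has only real zeros, no local maximum of `P` lies below `λ`. -/
theorem le_of_isLocalMax_of_splits {P : ℝ[X]} (hd : 0 < P.natDegree) {l x : ℝ}
    (hs : (P - C l).Splits) (hx : IsLocalMax (fun u => P.eval u) x) : l ≤ P.eval x := by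
  by_contra! hlt
  have hd0 := isLocalExtr_derivative_eval (Or.inr hx)
  -- At a critical point below `l`, Laguerre gives `P'' > 0`, so the maximum is also a minimum and
  -- `P` is locally constant, which is impossible.
  have hL := laguerre_inequality hs (x := x) (by simpa using hd) (by simp; linarith)
  simp [hd0] at hL
  have h2 : 0 < (derivative (derivative P)).eval x := by nlinarith
  have hmin : IsLocalMin (fun u => P.eval u) x := by
    apply isLocalMin_of_deriv_deriv_pos
    · have : deriv (fun u => P.eval u) = fun u => (derivative P).eval u := by
        ext u; exact Polynomial.deriv P
      rw [this, Polynomial.deriv]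
      exact h2
    · rw [Polynomial.deriv]; exact hd0
    · exact P.continuous.continuousAt
  refine Polynomial.not_eventually_const hd x (P.eval x) ?_
  filter_upwards [hx, hmin] with t h1 h2
  exact le_antisymm h1 h2

theorem le_of_isLocalMin_of_splits {P : ℝ[X]} (hd : 0 < P.natDegree) {l x : ℝ}
    (hs : (P - C l).Splits) (hx : IsLocalMin (fun u => P.eval u) x) : P.eval x ≤ l := by
  have hs' : (-P - C (-l)).Splits := by
    have := hs.neg
    rwa [show -P - C (-l) = -(P - C l) by simp; ring]
  have hx' : IsLocalMax (fun u => (-P).eval u) x := by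
    simpa using! hx.neg
  have := le_of_isLocalMax_of_splits (P := -P) (by simpa using hd) hs' hx'
  simp at this
  exact this

/-- A complex zero of `T - l` is a zero of `S_n(T) q_0`, that is of `p_{(n+1)K-1}`, and those are
real. -/
theorem periodPoly_sub_C_splits {K : ℕ} (hK : 1 ≤ K) {α : ℕ → ℝ} (hα : ∀ m, α (m + K) = α m)
    {n : ℕ} {l : ℝ} (hl : (Chebyshev.S ℝ n).eval l = 0) : (periodPoly α K - C l).Splits := by
  refine splits_of_forall_im_eq_zero fun z hz => ?_
  by_contra him
  have hT : aeval z (periodPoly α K) = algebraMap ℝ ℂ l := by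
    simpa [sub_eq_zero] using hz
  apply aeval_orthPoly_ne_zero α him ((n + 1) * K - 1)
  rw [orthPoly_period_eq hK hα, map_mul, aeval_comp, hT, aeval_algebraMap_apply_eq_algebraMap_eval,
    hl]
  simp

theorem chebyshev_S_eval_two_mul_cos_eq_zero {n k : ℕ} {θ : ℝ} (h0 : 0 < θ) (h1 : θ < Real.pi)
    (h : (n + 1) * θ = k * Real.pi) : (Chebyshev.S ℝ n).eval (2 * Real.cos θ) = 0 := by
  have := Chebyshev.S_two_mul_real_cos θ n
  push_cast at this
  rw [h, Real.sin_nat_mul_pi] at this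
  exact (mul_eq_zero.mp this).resolve_right (Real.sin_pos_of_pos_of_lt_pi h0 h1).ne'

theorem tendsto_two_mul_cos_pi_div :
    Filter.Tendsto (fun n : ℕ => 2 * Real.cos (Real.pi / (n + 2))) Filter.atTop (nhds 2) := by
  have h1 : Filter.Tendsto (fun n : ℕ => Real.pi / ((n : ℝ) + 2)) Filter.atTop (nhds 0) :=
    Filter.Tendsto.div_atTop tendsto_const_nhds
      (Filter.tendsto_atTop_add_const_right _ _ tendsto_natCast_atTop_atTop)
  simpa using ((Real.continuous_cos.tendsto 0).comp h1).const_mul 2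

theorem periodPoly_isLocalMax {K : ℕ} (hK : 1 ≤ K) {α : ℕ → ℝ} (hα : ∀ m, α (m + K) = α m)
    {x : ℝ} (hx : IsLocalMax (fun u => (periodPoly α K).eval u) x) :
    2 ≤ (periodPoly α K).eval x := by
  refine le_of_tendsto' tendsto_two_mul_cos_pi_div fun n => ?_
  refine le_of_isLocalMax_of_splits (by rw [periodPoly_natDegree]; omega)
    -- The level `2 cos(π/(n+2))` is a zero of `S_{n+1}`; the index starts at 1 because `S_0` has no
    -- zeros.
    (periodPoly_sub_C_splits hK hα (n := n + 1) ?_) hx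
  refine chebyshev_S_eval_two_mul_cos_eq_zero (k := 1) (by positivity)
    (div_lt_self Real.pi_pos (by have := n.cast_nonneg (α := ℝ); linarith)) ?_
  push_cast
  field_simp
  ring

theorem periodPoly_isLocalMin {K : ℕ} (hK : 1 ≤ K) {α : ℕ → ℝ} (hα : ∀ m, α (m + K) = α m)
    {x : ℝ} (hx : IsLocalMin (fun u => (periodPoly α K).eval u) x) :
    (periodPoly α K).eval x ≤ -2 := by
  refine ge_of_tendsto' tendsto_two_mul_cos_pi_div.neg fun n => ?_
  refine le_of_isLocalMin_of_splits (by rw [periodPoly_natDegree]; omega)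
    (periodPoly_sub_C_splits hK hα (n := n + 1) ?_) hx
  -- The negated level is the zero of `S_{n+1}` at the reflected angle `π - π/(n+2)`.
  rw [← mul_neg, ← Real.cos_pi_sub]
  have hn := n.cast_nonneg (α := ℝ)
  have hp : Real.pi / (n + 2) < Real.pi := div_lt_self Real.pi_pos (by linarith)
  have hp' : 0 < Real.pi / ((n : ℝ) + 2) := by positivity
  refine chebyshev_S_eval_two_mul_cos_eq_zero (k := n + 1) (by linarith) (by linarith) ?_
  push_cast
  field_simp
  ring

/-! ### Monotonicity intervals and bands -/

theorem strictMonoOn_or_strictAntiOn_of_injOn {f : ℝ → ℝ} {s : Set ℝ} (hs : s.OrdConnected)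
    (hf : ContinuousOn f s) (hi : InjOn f s) : StrictMonoOn f s ∨ StrictAntiOn f s := by
  by_contra! h
  simp only [StrictMonoOn, StrictAntiOn, not_forall, not_lt] at h
  obtain ⟨⟨a, ha, b, hb, hab, h1⟩, ⟨c, hc, d, hd, hcd, h2⟩⟩ := h
  have hmin : min a c ∈ s := by rcases min_choice a c with e | e <;> rw [e] <;> assumption
  have hmax : max b d ∈ s := by rcases max_choice b d with e | e <;> rw [e] <;> assumption
  have hsub := hs.out hmin hmax
  have ma : a ∈ Icc (min a c) (max b d) := ⟨min_le_left _ _, hab.le.trans (le_max_left _ _)⟩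
  have mb : b ∈ Icc (min a c) (max b d) := ⟨ma.1.trans hab.le, le_max_left _ _⟩
  have mc : c ∈ Icc (min a c) (max b d) := ⟨min_le_right _ _, hcd.le.trans (le_max_right _ _)⟩
  have md : d ∈ Icc (min a c) (max b d) := ⟨mc.1.trans hcd.le, le_max_right _ _⟩
  rcases (hf.mono hsub).strictMonoOn_of_injOn_Icc' (ma.1.trans ma.2) (hi.mono hsub) with h | h
  · exact (h ma mb hab).not_ge h1
  · exact (h mc md hcd).not_ge h2

theorem exists_isTurningSequence {P : ℝ[X]} (hd : 0 < P.natDegree) :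
    ∃ (s : ℕ) (ξ : Fin (s + 2) → EReal), IsTurningSequence P s ξ := by
  classical
  have hd' : derivative P ≠ 0 := by
    intro h
    have := derivative_eq_zero.mp h
    omega
  have hfin : {t : ℝ | IsLocalExtr (fun u => P.eval u) t}.Finite := by
    refine (derivative P).roots.toFinset.finite_toSet.subset fun t ht => ?_
    have := isLocalExtr_derivative_eval ht
    simp [hd', this]
  set E : Finset EReal := hfin.toFinset.map ⟨Real.toEReal, EReal.coe_injective⟩ with hE
  have hbot : (⊥ : EReal) ∉ insert ⊤ E := by simp [hE]
  have htop : (⊤ : EReal) ∉ E := by simp [hE]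
  have hcard : (insert ⊥ (insert ⊤ E)).card = E.card + 2 := by
    rw [Finset.card_insert_of_notMem hbot, Finset.card_insert_of_notMem htop]
  refine ⟨E.card, (insert ⊥ (insert ⊤ E)).orderEmbOfFin hcard,
    ((insert ⊥ (insert ⊤ E)).orderEmbOfFin hcard).strictMono, ?_, ?_, ?_⟩
  · have := Finset.orderEmbOfFin_zero hcard (by omega)
    refine Eq.trans this ?_
    exact le_bot_iff.mp (Finset.min'_le _ _ (by simp))
  · have := Finset.orderEmbOfFin_last hcard (by omega)
    refine Eq.trans this ?_
    exact top_le_iff.mp (Finset.le_max' _ _ (by simp))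
  · intro t
    rw [Finset.range_orderEmbOfFin]
    simp [hE]

theorem turningInterval_ordConnected {s : ℕ} (ξ : Fin (s + 2) → EReal) (j : Fin (s + 1)) :
    (turningInterval ξ j).OrdConnected :=
  ⟨fun _ ha _ hb _ ht => ⟨ha.1.trans (EReal.coe_le_coe_iff.mpr ht.1),
    (EReal.coe_le_coe_iff.mpr ht.2).trans hb.2⟩⟩

/-- `[c, d]` is the part of the `j`-th monotonicity interval on which `|P| ≤ 2`. -/
structure IsBand (P : ℝ[X]) (J : Set ℝ) (c d : ℝ) : Prop where
  lt : c < d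
  subset : Icc c d ⊆ J
  left : |P.eval c| = 2
  right : |P.eval d| = 2
  mem_iff : ∀ t ∈ J, |P.eval t| ≤ 2 ↔ t ∈ Icc c d

namespace IsTurningSequence

variable {P : ℝ[X]} {s : ℕ} {ξ : Fin (s + 2) → EReal}

theorem neg (h : IsTurningSequence P s ξ) : IsTurningSequence (-P) s ξ where
  strictMono := h.strictMono
  first := h.first
  last := h.last
  mem_range t := by
    rw [h.mem_range]
    constructor
    · intro hx
      simpa using! hx.neg
    · intro hx
      simpa using! hx.neg

/-- Two equal values would produce a local extremum strictly between them, hence a turning point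
strictly between two consecutive ones. -/
theorem injOn (h : IsTurningSequence P s ξ) (j : Fin (s + 1)) :
    InjOn (fun t => P.eval t) (turningInterval ξ j) := by
  have key : ∀ a ∈ turningInterval ξ j, ∀ b ∈ turningInterval ξ j, a < b →
      P.eval a ≠ P.eval b := by
    intro a ha b hb hab he
    obtain ⟨c, hc, hce⟩ := exists_isLocalExtr_Ioo hab P.continuous.continuousOn he
    obtain ⟨i, hi⟩ := (h.mem_range c).mpr hce
    have h1 : ξ j.castSucc < ξ i := hi ▸ ha.1.trans_lt (EReal.coe_lt_coe_iff.mpr hc.1)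
    have h2 : ξ i < ξ j.succ := hi ▸ (EReal.coe_lt_coe_iff.mpr hc.2).trans_le hb.2
    have h1' := h.strictMono.lt_iff_lt.mp h1
    have h2' := h.strictMono.lt_iff_lt.mp h2
    simp only [Fin.lt_def, Fin.val_castSucc, Fin.val_succ] at h1' h2'
    omega
  intro a ha b hb he
  rcases lt_trichotomy a b with hab | hab | hab
  · exact absurd he (key a ha b hb hab)
  · exact hab
  · exact absurd he.symm (key b hb a ha hab)

theorem strictMonoOn_or_strictAntiOn (h : IsTurningSequence P s ξ) (j : Fin (s + 1)) :
    StrictMonoOn (fun t => P.eval t) (turningInterval ξ j) ∨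
      StrictAntiOn (fun t => P.eval t) (turningInterval ξ j) :=
  strictMonoOn_or_strictAntiOn_of_injOn (turningInterval_ordConnected ξ j)
    P.continuous.continuousOn (h.injOn j)

theorem exists_mem_turningInterval (h : IsTurningSequence P s ξ) (t : ℝ) :
    ∃ j, t ∈ turningInterval ξ j := by
  have key : ∀ n : ℕ, ∀ hn : n < s + 2, (t : EReal) ≤ ξ ⟨n, hn⟩ →
      ∃ j, t ∈ turningInterval ξ j := by
    intro n
    induction n with
    | zero =>
      intro hn ht
      have : ξ ⟨0, hn⟩ = ⊥ := h.first
      rw [this] at ht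
      simp at ht
    | succ n ih =>
      intro hn ht
      rcases le_total (t : EReal) (ξ ⟨n, by omega⟩) with h1 | h1
      · exact ih _ h1
      · exact ⟨⟨n, by omega⟩, h1, ht⟩
  refine key (s + 1) (by omega) ?_
  have : ξ ⟨s + 1, by omega⟩ = ⊤ := h.last
  simp [this]

theorem lt_succ (h : IsTurningSequence P s ξ) (j : Fin (s + 1)) : ξ j.castSucc < ξ j.succ :=
  h.strictMono Fin.castSucc_lt_succ

theorem exists_mem_lt (h : IsTurningSequence P s ξ) (j : Fin (s + 1)) :
    ∃ a b : ℝ, a < b ∧ a ∈ turningInterval ξ j ∧ b ∈ turningInterval ξ j := by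
  obtain ⟨a, ha1, ha2⟩ := EReal.lt_iff_exists_real_btwn.mp (h.lt_succ j)
  obtain ⟨b, hb1, hb2⟩ := EReal.lt_iff_exists_real_btwn.mp ha2
  exact ⟨a, b, EReal.coe_lt_coe_iff.mp hb1, ⟨ha1.le, ha2.le⟩, ⟨(ha1.trans hb1).le, hb2.le⟩⟩

/-- On a monotonicity interval where `P` increases, it reaches every value that is at most the
values at the local maxima. -/
theorem exists_le_eval_of_strictMonoOn (h : IsTurningSequence P s ξ) (hd : 0 < P.natDegree)
    {m : ℝ} (hmax : ∀ x, IsLocalMax (fun u => P.eval u) x → m ≤ P.eval x) {j : Fin (s + 1)}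
    (hmono : StrictMonoOn (fun t => P.eval t) (turningInterval ξ j)) :
    ∃ b ∈ turningInterval ξ j, m ≤ P.eval b := by
  obtain ⟨a₀, b₀, hab, ha₀, hb₀⟩ := h.exists_mem_lt j
  have hlt := h.lt_succ j
  have hev : ∀ v : ℝ, ξ j.succ = v → m ≤ P.eval v := by
    intro v hv
    have hvm : v ∈ turningInterval ξ j := ⟨hv ▸ hlt.le, hv ▸ le_rfl⟩
    have hav : a₀ < v := hab.trans_le (EReal.coe_le_coe_iff.mp (hv ▸ hb₀.2))
    rcases (h.mem_range v).mp ⟨_, hv⟩ with hx | hx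
    -- A right endpoint cannot be a local minimum, since `P` increases strictly up to it.
    · exfalso
      have h1 : ∀ᶠ t in nhdsWithin v (Iio v), P.eval v ≤ P.eval t := hx.filter_mono
        nhdsWithin_le_nhds
      have h2 : ∀ᶠ t in nhdsWithin v (Iio v), t ∈ Ioo a₀ v := Ioo_mem_nhdsLT hav
      obtain ⟨t, ht1, ht2⟩ := (h1.and h2).exists
      have htm := (turningInterval_ordConnected ξ j).out ha₀ hvm ⟨ht2.1.le, ht2.2.le⟩
      exact (hmono htm hvm ht2.2).not_ge ht1
    · exact hmax v hx
  induction hv : ξ j.succ with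
  | bot => rw [hv] at hlt; simp at hlt
  | coe v => exact ⟨v, ⟨hv ▸ hlt.le, hv ▸ le_rfl⟩, hev v hv⟩
  | top =>
    have hmem : ∀ t, a₀ ≤ t → t ∈ turningInterval ξ j := fun t ht =>
      ⟨ha₀.1.trans (EReal.coe_le_coe_iff.mpr ht), hv ▸ le_top⟩
    -- On an unbounded interval, a monotone `P` staying below `m` would be bounded near infinity,
    -- unlike a nonconstant polynomial.
    by_contra! hcon
    have hb : ∀ᶠ t in Filter.atTop, |P.eval t| ≤ max |P.eval a₀| |m| := by
      filter_upwards [Filter.eventually_ge_atTop a₀] with t ht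
      have h1 := hmono.monotoneOn ha₀ (hmem t ht) ht
      have h2 := hcon t (hmem t ht)
      have h1' : P.eval a₀ ≤ P.eval t := h1
      rw [abs_le]
      exact ⟨by linarith [neg_abs_le (P.eval a₀), le_max_left |P.eval a₀| |m|],
        by linarith [le_abs_self m, le_max_right |P.eval a₀| |m|]⟩
    have htop : Filter.Tendsto (fun t => |P.eval t|) Filter.atTop Filter.atTop :=
      P.tendsto_norm_atTop (natDegree_pos_iff_degree_pos.mp hd) tendsto_norm_atTop_atTop
    obtain ⟨t, ht1, ht2⟩ := (hb.and (htop.eventually_gt_atTop (max |P.eval a₀| |m|))).exists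
    exact ht1.not_gt ht2

theorem exists_eval_le_of_strictMonoOn (h : IsTurningSequence P s ξ) (hd : 0 < P.natDegree)
    {m : ℝ} (hmin : ∀ x, IsLocalMin (fun u => P.eval u) x → P.eval x ≤ m) {j : Fin (s + 1)}
    (hmono : StrictMonoOn (fun t => P.eval t) (turningInterval ξ j)) :
    ∃ a ∈ turningInterval ξ j, P.eval a ≤ m := by
  obtain ⟨a₀, b₀, hab, ha₀, hb₀⟩ := h.exists_mem_lt j
  have hlt := h.lt_succ j
  have hev : ∀ v : ℝ, ξ j.castSucc = v → P.eval v ≤ m := by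
    intro v hv
    have hvm : v ∈ turningInterval ξ j := ⟨hv ▸ le_rfl, hv ▸ hlt.le⟩
    have hav : v < b₀ := (EReal.coe_le_coe_iff.mp (hv ▸ ha₀.1)).trans_lt hab
    rcases (h.mem_range v).mp ⟨_, hv⟩ with hx | hx
    · exact hmin v hx
    · exfalso
      have h1 : ∀ᶠ t in nhdsWithin v (Ioi v), P.eval t ≤ P.eval v := hx.filter_mono
        nhdsWithin_le_nhds
      have h2 : ∀ᶠ t in nhdsWithin v (Ioi v), t ∈ Ioo v b₀ := Ioo_mem_nhdsGT hav
      obtain ⟨t, ht1, ht2⟩ := (h1.and h2).exists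
      have htm := (turningInterval_ordConnected ξ j).out hvm hb₀ ⟨ht2.1.le, ht2.2.le⟩
      exact (hmono hvm htm ht2.1).not_ge ht1
  induction hv : ξ j.castSucc with
  | top => rw [hv] at hlt; simp at hlt
  | coe v => exact ⟨v, ⟨hv ▸ le_rfl, hv ▸ hlt.le⟩, hev v hv⟩
  | bot =>
    have hmem : ∀ t, t ≤ b₀ → t ∈ turningInterval ξ j := fun t ht =>
      ⟨hv ▸ bot_le, (EReal.coe_le_coe_iff.mpr ht).trans hb₀.2⟩
    by_contra! hcon
    have hb : ∀ᶠ t in Filter.atBot, |P.eval t| ≤ max |P.eval b₀| |m| := by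
      filter_upwards [Filter.eventually_le_atBot b₀] with t ht
      have h1 : P.eval t ≤ P.eval b₀ := hmono.monotoneOn (hmem t ht) hb₀ ht
      have h2 := hcon t (hmem t ht)
      rw [abs_le]
      exact ⟨by linarith [neg_abs_le m, le_max_right |P.eval b₀| |m|],
        by linarith [le_abs_self (P.eval b₀), le_max_left |P.eval b₀| |m|]⟩
    have htop : Filter.Tendsto (fun t => |P.eval t|) Filter.atBot Filter.atTop :=
      P.tendsto_norm_atTop (natDegree_pos_iff_degree_pos.mp hd) Filter.tendsto_abs_atBot_atTop
    obtain ⟨t, ht1, ht2⟩ := (hb.and (htop.eventually_gt_atTop (max |P.eval b₀| |m|))).exists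
    exact ht1.not_gt ht2

theorem exists_isBand_of_strictMonoOn (h : IsTurningSequence P s ξ) (hd : 0 < P.natDegree)
    (hmax : ∀ x, IsLocalMax (fun u => P.eval u) x → 2 ≤ P.eval x)
    (hmin : ∀ x, IsLocalMin (fun u => P.eval u) x → P.eval x ≤ -2) {j : Fin (s + 1)}
    (hmono : StrictMonoOn (fun t => P.eval t) (turningInterval ξ j)) :
    Icc (-2) 2 ⊆ (fun t => P.eval t) '' turningInterval ξ j ∧
      ∃ c d, IsBand P (turningInterval ξ j) c d := by
  have hoc := turningInterval_ordConnected ξ j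
  obtain ⟨b, hb, hb2⟩ := h.exists_le_eval_of_strictMonoOn hd hmax hmono
  obtain ⟨a, ha, ha2⟩ := h.exists_eval_le_of_strictMonoOn hd hmin hmono
  have himg : Icc (-2) 2 ⊆ (fun t => P.eval t) '' turningInterval ξ j := by
    have := hoc.isPreconnected.image _ P.continuous.continuousOn |>.ordConnected.out
      (mem_image_of_mem _ ha) (mem_image_of_mem _ hb)
    exact fun y hy => this ⟨ha2.trans hy.1, hy.2.trans hb2⟩
  refine ⟨himg, ?_⟩
  obtain ⟨c, hc, hc2⟩ := himg (show (-2 : ℝ) ∈ Icc (-2) 2 by norm_num)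
  obtain ⟨d, hd, hd2⟩ := himg (show (2 : ℝ) ∈ Icc (-2) 2 by norm_num)
  simp only at hc2 hd2
  refine ⟨c, d, ?_, hoc.out hc hd, by simp [hc2], by simp [hd2], ?_⟩
  · refine (hmono.lt_iff_lt hc hd).mp ?_
    simp only [hc2, hd2]
    norm_num
  · intro t ht
    rw [abs_le, ← hc2, ← hd2]
    exact and_congr (hmono.le_iff_le hc ht) (hmono.le_iff_le ht hd)

/-- The decreasing case is the increasing one for `-P`, which has the same turning points and the
same bands. -/
theorem exists_isBand (h : IsTurningSequence P s ξ) (hd : 0 < P.natDegree)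
    (hmax : ∀ x, IsLocalMax (fun u => P.eval u) x → 2 ≤ P.eval x)
    (hmin : ∀ x, IsLocalMin (fun u => P.eval u) x → P.eval x ≤ -2) (j : Fin (s + 1)) :
    Icc (-2) 2 ⊆ (fun t => P.eval t) '' turningInterval ξ j ∧
      ∃ c d, IsBand P (turningInterval ξ j) c d := by
  rcases h.strictMonoOn_or_strictAntiOn j with hm | hm
  · exact h.exists_isBand_of_strictMonoOn hd hmax hmin hm
  · obtain ⟨h1, c, d, hb⟩ := h.neg.exists_isBand_of_strictMonoOn (by simpa using hd)
      (fun x hx => by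
        have : IsLocalMin (fun u => P.eval u) x := by simpa using! hx.neg
        simpa using neg_le_neg (hmin x this))
      (fun x hx => by
        have : IsLocalMax (fun u => P.eval u) x := by simpa using! hx.neg
        simpa using hmax x this)
      (j := j) (by simpa using! hm.neg)
    refine ⟨fun y hy => ?_, c, d, hb.lt, hb.subset, by simpa using hb.left,
      by simpa using hb.right, by simpa using hb.mem_iff⟩
    obtain ⟨t, ht, hty⟩ := h1 (show -y ∈ Icc (-2) 2 from ⟨by linarith [hy.2], by linarith [hy.1]⟩)
    exact ⟨t, ht, by simpa using hty⟩

theorem isUniqueBand (h : IsTurningSequence P s ξ) {j : Fin (s + 1)} {c d : ℝ}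
    (hb : IsBand P (turningInterval ξ j) c d) : IsUniqueBand P (turningInterval ξ j) c d := by
  refine ⟨⟨hb.lt, hb.subset, hb.left, hb.right⟩, fun c' d' hlt hsub hc hd => ?_⟩
  have mem : ∀ {a b : ℝ}, a < b → a ∈ Icc a b ∧ b ∈ Icc a b := fun hab =>
    ⟨left_mem_Icc.mpr hab.le, right_mem_Icc.mpr hab.le⟩
  have key : ∀ e ∈ turningInterval ξ j, |P.eval e| = 2 → e = c ∨ e = d := by
    intro e he he2
    have hinj := h.injOn j
    have hne : P.eval c ≠ P.eval d := fun hcd =>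
      hb.lt.ne (hinj (hb.subset (mem hb.lt).1) (hb.subset (mem hb.lt).2) hcd)
    have hor : P.eval e = P.eval c ∨ P.eval e = P.eval d := by
      have h1 := hb.left
      have h2 := hb.right
      rw [abs_eq (by norm_num)] at h1 h2 he2
      grind
    exact hor.imp (fun x => hinj he (hb.subset (mem hb.lt).1) x)
      (fun x => hinj he (hb.subset (mem hb.lt).2) x)
  have h1 := key c' (hsub (mem hlt).1) hc
  have h2 := key d' (hsub (mem hlt).2) hd
  have := hb.lt
  grind

theorem abs_eval_lt_two (h : IsTurningSequence P s ξ) {j : Fin (s + 1)} {c d t : ℝ}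
    (hb : IsBand P (turningInterval ξ j) c d) (ht : t ∈ Ioo c d) : |P.eval t| < 2 := by
  have htJ := hb.subset ⟨ht.1.le, ht.2.le⟩
  refine lt_of_le_of_ne ((hb.mem_iff t htJ).mpr ⟨ht.1.le, ht.2.le⟩) fun h2 => ?_
  have := (h.isUniqueBand hb).2 c t ht.1
    ((Icc_subset_Icc_right ht.2.le).trans hb.subset) hb.left h2
  exact ht.2.ne this.2

theorem iUnion_Icc_eq (h : IsTurningSequence P s ξ) {c d : Fin (s + 1) → ℝ}
    (hb : ∀ j, IsBand P (turningInterval ξ j) (c j) (d j)) :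
    ⋃ j, Icc (c j) (d j) = {t | |P.eval t| ≤ 2} := by
  ext t
  simp only [mem_iUnion, mem_ofPred_eq]
  constructor
  · rintro ⟨j, hj⟩
    exact ((hb j).mem_iff t ((hb j).subset hj)).mpr hj
  · intro ht
    obtain ⟨j, hj⟩ := h.exists_mem_turningInterval t
    exact ⟨j, ((hb j).mem_iff t hj).mp ht⟩

theorem right_le_left (h : IsTurningSequence P s ξ) {c d : Fin (s + 1) → ℝ}
    (hb : ∀ j, IsBand P (turningInterval ξ j) (c j) (d j)) {k l : Fin (s + 1)} (hkl : k < l) :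
    d k ≤ c l := by
  have h1 := ((hb k).subset (right_mem_Icc.mpr (hb k).lt.le)).2
  have h2 := ((hb l).subset (left_mem_Icc.mpr (hb l).lt.le)).1
  have h3 : ξ k.succ ≤ ξ l.castSucc := h.strictMono.monotone (by
    simp only [Fin.le_def, Fin.val_castSucc, Fin.val_succ]; exact hkl)
  exact EReal.coe_le_coe_iff.mp (h1.trans (h3.trans h2))

end IsTurningSequence

/-! ### Moment determinacy and the Chebyshev measure -/

theorem integral_eval_eq_of_integral_chebyshev_U_eq {μ ν : Measure ℝ}
    (hμ : ∀ P : ℝ[X], Integrable (fun x => P.eval x) μ)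
    (hν : ∀ P : ℝ[X], Integrable (fun x => P.eval x) ν)
    (h : ∀ n : ℕ, ∫ x, (Chebyshev.U ℝ n).eval x ∂μ = ∫ x, (Chebyshev.U ℝ n).eval x ∂ν)
    (P : ℝ[X]) : ∫ x, P.eval x ∂μ = ∫ x, P.eval x ∂ν := by
  -- Induction on `k` for all `n` at once, through `2x U_n = U_{n+1} + U_{n-1}`; for `n = 0` the
  -- last term is `U_{-1} = 0`.
  have key : ∀ k n : ℕ, ∫ x, (X ^ k * Chebyshev.U ℝ n).eval x ∂μ =
      ∫ x, (X ^ k * Chebyshev.U ℝ n).eval x ∂ν := by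
    intro k
    induction k with
    | zero => simpa using h
    | succ k ih =>
      intro n
      have hn : ∫ x, (X ^ k * Chebyshev.U ℝ ((n : ℤ) - 1)).eval x ∂μ =
          ∫ x, (X ^ k * Chebyshev.U ℝ ((n : ℤ) - 1)).eval x ∂ν := by
        cases n with
        | zero => simp
        | succ n => simpa using ih n
      have hrec : ∀ x : ℝ, (X ^ (k + 1) * Chebyshev.U ℝ n).eval x =
          2⁻¹ * ((X ^ k * Chebyshev.U ℝ ((n + 1 : ℕ) : ℤ)).eval x +
            (X ^ k * Chebyshev.U ℝ ((n : ℤ) - 1)).eval x) := by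
        intro x
        push_cast
        rw [Chebyshev.U_add_one]
        simp
        ring
      simp_rw [hrec]
      rw [integral_const_mul, integral_const_mul, integral_add (hμ _) (hμ _),
        integral_add (hν _) (hν _), ih, hn]
  induction P using Polynomial.induction_on' with
  | add p q hp hq =>
    simp only [eval_add]
    rw [integral_add (hμ p) (hμ q), integral_add (hν p) (hν q), hp, hq]
  | monomial n a =>
    have := key n 0
    simp only [← C_mul_X_pow_eq_monomial, eval_mul, eval_C]
    rw [integral_const_mul, integral_const_mul]
    simpa using Or.inl this

/-- By Markov's inequality, mass on `|x| ≥ a > 1` would make the even moments grow at least like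
`a^(2n)`. -/
theorem measure_compl_Icc_eq_zero_of_integral_pow_le {μ : Measure ℝ} [IsFiniteMeasure μ] {c : ℝ}
    (hμ : ∀ n : ℕ, Integrable (fun x : ℝ => x ^ n) μ)
    (h : ∀ n : ℕ, ∫ x, x ^ (2 * n) ∂μ ≤ c) : μ (Icc (-1) 1)ᶜ = 0 := by
  have key : ∀ a : ℝ, 1 < a → μ {x | a ≤ |x|} = 0 := by
    intro a ha
    have hle : ∀ n : ℕ, a ^ (2 * n) * μ.real {x | a ≤ |x|} ≤ c := by
      intro n
      have h1 := mul_meas_ge_le_integral_of_nonneg (μ := μ) (f := fun x : ℝ => x ^ (2 * n))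
        (Filter.Eventually.of_forall fun x => (even_two_mul n).pow_nonneg x) (hμ _) (a ^ (2 * n))
      refine le_trans ?_ (h1.trans (h n))
      refine mul_le_mul_of_nonneg_left (measureReal_mono fun x hx => ?_) (by positivity)
      have hx' : a ≤ |x| := hx
      have h2 : a ^ (2 * n) ≤ |x| ^ (2 * n) := pow_le_pow_left₀ (by linarith) hx' _
      rwa [(even_two_mul n).pow_abs] at h2
    by_contra hne
    have hpos : 0 < μ.real {x | a ≤ |x|} :=
      ENNReal.toReal_pos hne (measure_ne_top _ _)
    obtain ⟨n, hn⟩ := pow_unbounded_of_one_lt (c / μ.real {x | a ≤ |x|}) (one_lt_pow₀ ha two_ne_zero)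
    rw [div_lt_iff₀ hpos, ← pow_mul] at hn
    exact (hle n).not_gt hn
  have hsub : (Icc (-1 : ℝ) 1)ᶜ ⊆ ⋃ n : ℕ, {x : ℝ | 1 + 1 / ((n : ℝ) + 1) ≤ |x|} := by
    intro x hx
    have hx1 : 1 < |x| := by
      by_contra! hle
      exact hx (abs_le.mp hle)
    obtain ⟨n, hn⟩ := exists_nat_one_div_lt (sub_pos.mpr hx1)
    exact mem_iUnion.mpr ⟨n, by simp only [mem_ofPred_eq]; linarith⟩
  refine measure_mono_null hsub (measure_iUnion_null fun n => key _ ?_)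
  have : 0 < 1 / ((n : ℝ) + 1) := by positivity
  linarith

/-- Bounded even moments first confine `μ` to `[-1, 1]` as well; Weierstrass approximation there
then settles the comparison. -/
theorem measure_eq_of_integral_eval_eq {μ ν : Measure ℝ} [IsFiniteMeasure μ] [IsFiniteMeasure ν]
    (hμ : ∀ P : ℝ[X], Integrable (fun x => P.eval x) μ)
    (hν : ∀ P : ℝ[X], Integrable (fun x => P.eval x) ν) (hs : ν (Icc (-1) 1)ᶜ = 0)
    (h : ∀ P : ℝ[X], ∫ x, P.eval x ∂μ = ∫ x, P.eval x ∂ν) : μ = ν := by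
  have aeν : ∀ᵐ x ∂ν, x ∈ Icc (-1 : ℝ) 1 := hs
  have hs' : μ (Icc (-1) 1)ᶜ = 0 := by
    refine measure_compl_Icc_eq_zero_of_integral_pow_le (c := ν.real univ)
      (fun n => by simpa using hμ (X ^ n)) fun n => ?_
    have h1 := h (X ^ (2 * n))
    simp only [eval_pow, eval_X] at h1
    rw [h1]
    calc ∫ x, x ^ (2 * n) ∂ν ≤ ∫ x, (1 : ℝ) ∂ν := by
          refine integral_mono_ae (by simpa using hν (X ^ (2 * n))) (integrable_const _) ?_
          filter_upwards [aeν] with x hx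
          have := pow_le_one₀ (n := 2 * n) (abs_nonneg x) (abs_le.mpr hx)
          rwa [(even_two_mul n).pow_abs] at this
      _ = ν.real univ := by simp
  have aeμ : ∀ᵐ x ∂μ, x ∈ Icc (-1 : ℝ) 1 := hs'
  refine ext_of_forall_integral_eq_of_IsFiniteMeasure fun f => ?_
  have bound : ∀ (ρ : Measure ℝ) [IsFiniteMeasure ρ], (∀ᵐ x ∂ρ, x ∈ Icc (-1 : ℝ) 1) →
      (∀ P : ℝ[X], Integrable (fun x => P.eval x) ρ) → ∀ (ε : ℝ) (P : ℝ[X]),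
      (∀ x ∈ Icc (-1 : ℝ) 1, |P.eval x - f x| < ε) →
      |∫ x, P.eval x ∂ρ - ∫ x, f x ∂ρ| ≤ ε * ρ.real univ := by
    intro ρ _ hae hint ε P hP
    rw [← integral_sub (hint P) (f.integrable ρ)]
    have hle : ∀ᵐ x ∂ρ, ‖P.eval x - f x‖ ≤ ε := by
      filter_upwards [hae] with x hx using (hP x hx).le
    exact norm_integral_le_of_norm_le_const hle
  have hC : 0 < μ.real univ + ν.real univ + 1 := by positivity
  refine eq_of_abs_sub_le_all fun ε hε => ?_
  obtain ⟨P, hP⟩ := exists_polynomial_near_of_continuousOn (-1) 1 f f.continuous.continuousOn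
    (ε / (μ.real univ + ν.real univ + 1)) (by positivity)
  have b1 := bound μ aeμ hμ _ P hP
  have b2 := bound ν aeν hν _ P hP
  rw [h P] at b1
  have b3 : ε / (μ.real univ + ν.real univ + 1) * μ.real univ +
      ε / (μ.real univ + ν.real univ + 1) * ν.real univ ≤ ε := by
    rw [← mul_add, div_mul_eq_mul_div, div_le_iff₀ hC]
    nlinarith
  rw [abs_le] at *
  constructor <;> linarith [b1.1, b1.2, b2.1, b2.2]

theorem integral_chebyshevMeasure (f : ℝ → ℝ) :
    ∫ x, f x ∂chebyshevMeasure = ∫ x in -1..1, f x * (2 / Real.pi * Real.sqrt (1 - x ^ 2)) := by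
  rw [chebyshevMeasure, integral_withDensity_eq_integral_toReal_smul (by fun_prop) (by simp),
    intervalIntegral.integral_of_le (by norm_num), integral_Icc_eq_integral_Ioc]
  refine integral_congr_ae (Filter.Eventually.of_forall fun x => ?_)
  simp only [smul_eq_mul]
  rw [ENNReal.toReal_ofReal (by positivity), mul_comm]

theorem chebyshevMeasure_compl_Icc : chebyshevMeasure (Icc (-1) 1)ᶜ = 0 := by
  refine withDensity_absolutelyContinuous _ _ ?_
  rw [Measure.restrict_apply measurableSet_Icc.compl]
  simp

instance : IsFiniteMeasure chebyshevMeasure := by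
  refine isFiniteMeasure_withDensity_ofReal ?_
  have : IntegrableOn (fun x : ℝ => 2 / Real.pi * Real.sqrt (1 - x ^ 2)) (Icc (-1) 1) :=
    ContinuousOn.integrableOn_Icc (by fun_prop)
  exact this.2

theorem integrable_of_continuous_of_compl_Icc {ν : Measure ℝ} [IsFiniteMeasure ν] {a b : ℝ}
    (hs : ν (Icc a b)ᶜ = 0) {f : ℝ → ℝ} (hf : Continuous f) : Integrable f ν := by
  have : IntegrableOn f (Icc a b) ν := hf.continuousOn.integrableOn_Icc
  rwa [IntegrableOn, Measure.restrict_eq_self_of_ae_mem (show ∀ᵐ x ∂ν, x ∈ Icc a b from hs)] at this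

theorem integral_chebyshev_U_chebyshevMeasure (n : ℕ) :
    ∫ x, (Chebyshev.U ℝ n).eval x ∂chebyshevMeasure = if n = 0 then 1 else 0 := by
  -- This is `2 (1 - x²) U_n = T_n - T_{n+2}` divided by `√(1 - x²)`, reducing the claim to
  -- integrals of first-kind polynomials.
  have e : ∫ x, (Chebyshev.U ℝ n).eval x ∂chebyshevMeasure =
      ∫ x, Real.pi⁻¹ * ((Chebyshev.T ℝ n).eval x - (Chebyshev.T ℝ (n + 2)).eval x)
        ∂Chebyshev.measureT := by
    rw [integral_chebyshevMeasure, Chebyshev.integral_measureT]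
    refine intervalIntegral.integral_congr fun x hx => ?_
    rw [uIcc_of_le (by norm_num)] at hx
    have hnn : 0 ≤ 1 - x ^ 2 := by nlinarith [hx.1, hx.2]
    have h1 : Real.sqrt (1 - x ^ 2) = (1 - x ^ 2) * √(1 - x ^ 2)⁻¹ := by
      rw [Real.sqrt_inv]
      rcases hnn.eq_or_lt with h0 | h0
      · simp [← h0]
      · have := Real.sqrt_pos.mpr h0
        field_simp
        rw [Real.sq_sqrt hnn]
    have h2 := congrArg (fun P => P.eval x) (Chebyshev.one_sub_X_sq_mul_U_eq_pol_in_T ℝ n)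
    have h3 := congrArg (fun P => P.eval x) (Chebyshev.T_add_two ℝ n)
    simp only [eval_mul, eval_sub, eval_one, eval_pow, eval_X, eval_ofNat] at h2 h3
    rw [h1]
    linear_combination (2 * Real.pi⁻¹ * √(1 - x ^ 2)⁻¹) * h2 -
      (Real.pi⁻¹ * √(1 - x ^ 2)⁻¹) * h3
  rw [e, integral_const_mul, integral_sub (Chebyshev.integrable_measureT (by fun_prop))
    (Chebyshev.integrable_measureT (by fun_prop)),
    Chebyshev.integral_eval_T_real_measureT_of_ne_zero (n := (n : ℤ) + 2) (by omega)]
  split_ifs with h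
  · subst h
    rw [Nat.cast_zero, Chebyshev.integral_eval_T_real_measureT_zero]
    simp [Real.pi_ne_zero]
  · rw [Chebyshev.integral_eval_T_real_measureT_of_ne_zero (by exact_mod_cast h)]
    simp

/-! ### Orthogonality relations and points of the support -/

theorem christoffel_darboux (α : ℕ → ℝ) (t₀ : ℝ) (N : ℕ) :
    (X - C t₀) * ∑ m ∈ Finset.range (N + 1), C ((orthPoly α m).eval t₀) * orthPoly α m =
      C ((orthPoly α N).eval t₀) * orthPoly α (N + 1) -
        C ((orthPoly α (N + 1)).eval t₀) * orthPoly α N := by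
  induction N with
  | zero => simp [orthPoly]
  | succ N ih =>
    rw [Finset.sum_range_succ, mul_add, ih, orthPoly_add_two]
    simp
    ring

namespace IsOrthogonalityMeasure

variable {α : ℕ → ℝ} {φ : Measure ℝ}

theorem isFiniteMeasure {p : ℕ → ℝ[X]} (h : IsOrthogonalityMeasure p φ) : IsFiniteMeasure φ := by
  have := h.integrable_pow 0
  simp only [pow_zero] at this
  exact (integrable_const_iff_isFiniteMeasure one_ne_zero).mp this

theorem integrable_eval {p : ℕ → ℝ[X]} (h : IsOrthogonalityMeasure p φ) (P : ℝ[X]) :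
    Integrable (fun t => P.eval t) φ := by
  induction P using Polynomial.induction_on' with
  | add p q hp hq => simpa using! hp.add hq
  | monomial n a => simpa using (h.integrable_pow n).const_mul a

theorem integral_sq (h : IsOrthogonalityMeasure (orthPoly α) φ) (m : ℕ) :
    ∫ t, (orthPoly α m).eval t * (orthPoly α m).eval t ∂φ = φ.real univ := by
  -- Because `p_{m-1}` enters the recurrence with coefficient 1, both squared norms equal the
  -- integral of `t p_m p_{m+1}`.
  have key : ∀ m, ∫ t, (orthPoly α (m + 1) * orthPoly α (m + 1)).eval t ∂φ =
      ∫ t, (X * orthPoly α m * orthPoly α (m + 1)).eval t ∂φ ∧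
      ∫ t, (X * orthPoly α m * orthPoly α (m + 1)).eval t ∂φ =
      ∫ t, (orthPoly α m * orthPoly α m).eval t ∂φ := by
    intro m
    have o1 : ∫ t, (orthPoly α m * orthPoly α (m + 1)).eval t ∂φ = 0 := by
      simpa using h.orthogonal m (m + 1) (by omega)
    have o2 : ∫ t, (orthPoly α m * orthPoly α (m + 2)).eval t ∂φ = 0 := by
      simpa using h.orthogonal m (m + 2) (by omega)
    constructor
    · rw [← sub_eq_zero, ← integral_sub (h.integrable_eval _) (h.integrable_eval _)]
      cases m with
      | zero =>
        have : ∀ t, (orthPoly α (0 + 1) * orthPoly α (0 + 1)).eval t -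
            (X * orthPoly α 0 * orthPoly α (0 + 1)).eval t =
            -α 0 * (orthPoly α 0 * orthPoly α (0 + 1)).eval t := by
          intro t; simp [orthPoly]; ring
        simp_rw [this]
        rw [integral_const_mul, o1, mul_zero]
      | succ k =>
        have o3 : ∫ t, (orthPoly α k * orthPoly α (k + 2)).eval t ∂φ = 0 := by
          simpa using h.orthogonal k (k + 2) (by omega)
        have : ∀ t, (orthPoly α (k + 1 + 1) * orthPoly α (k + 1 + 1)).eval t -
            (X * orthPoly α (k + 1) * orthPoly α (k + 1 + 1)).eval t =
            -α (k + 1) * (orthPoly α (k + 1) * orthPoly α (k + 1 + 1)).eval t -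
              (orthPoly α k * orthPoly α (k + 2)).eval t := by
          intro t
          have := congrArg (fun P => P.eval t) (orthPoly_add_two α k)
          simp at this ⊢
          linear_combination (eval t (orthPoly α (k + 1 + 1))) * this
        simp_rw [this]
        rw [integral_sub ((h.integrable_eval _).const_mul _) (h.integrable_eval _),
          integral_const_mul, o1, o3]
        simp
    · rw [← sub_eq_zero, ← integral_sub (h.integrable_eval _) (h.integrable_eval _)]
      have : ∀ t, (X * orthPoly α m * orthPoly α (m + 1)).eval t -
          (orthPoly α m * orthPoly α m).eval t =
          α (m + 1) * (orthPoly α m * orthPoly α (m + 1)).eval t +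
            (orthPoly α m * orthPoly α (m + 2)).eval t := by
        intro t
        rw [orthPoly_add_two]
        simp
        ring
      simp_rw [this]
      rw [integral_add ((h.integrable_eval _).const_mul _) (h.integrable_eval _),
        integral_const_mul, o1, o2]
      simp
  simp only [← eval_mul]
  induction m with
  | zero => simp [orthPoly]
  | succ m ih => rw [(key m).1, (key m).2, ih]

theorem integral_mul (h : IsOrthogonalityMeasure (orthPoly α) φ) (m n : ℕ) :
    ∫ t, (orthPoly α m).eval t * (orthPoly α n).eval t ∂φ = if m = n then φ.real univ else 0 := by
  split_ifs with e
  · rw [e, h.integral_sq]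
  · exact h.orthogonal m n e

/-- The squared norm of a linear combination of the `p_m`. -/
theorem integral_sum_sq (h : IsOrthogonalityMeasure (orthPoly α) φ) (s : Finset ℕ) (w : ℕ → ℝ) :
    ∫ t, (∑ m ∈ s, C (w m) * orthPoly α m).eval t ^ 2 ∂φ =
      φ.real univ * ∑ m ∈ s, w m ^ 2 := by
  have e : ∀ t, (∑ m ∈ s, C (w m) * orthPoly α m).eval t ^ 2 =
      ∑ m ∈ s, ∑ n ∈ s, w m * w n * ((orthPoly α m).eval t * (orthPoly α n).eval t) := by
    intro t
    rw [eval_finsetSum, sq, Finset.sum_mul_sum]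
    refine Finset.sum_congr rfl fun m _ => Finset.sum_congr rfl fun n _ => ?_
    simp
    ring
  have hint : ∀ m n, Integrable
      (fun t => w m * w n * ((orthPoly α m).eval t * (orthPoly α n).eval t)) φ := by
    intro m n
    simpa using (h.integrable_eval (orthPoly α m * orthPoly α n)).const_mul (w m * w n)
  simp_rw [e]
  rw [integral_finsetSum _ fun m _ => integrable_finsetSum _ fun n _ => hint m n, Finset.mul_sum]
  refine Finset.sum_congr rfl fun m hm => ?_
  rw [integral_finsetSum _ fun n _ => hint m n]
  simp_rw [integral_const_mul, h.integral_mul]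
  simp [hm]
  ring

/-- If `φ` vanishes near `t₀`, the values `p_m(t₀)` grow exponentially. -/
theorem sum_sq_le (h : IsOrthogonalityMeasure (orthPoly α) φ) {t₀ ε : ℝ} (hε : 0 < ε)
    (h0 : φ (Ioo (t₀ - ε) (t₀ + ε)) = 0) (N : ℕ) :
    ε ^ 2 * ∑ m ∈ Finset.range (N + 1), (orthPoly α m).eval t₀ ^ 2 ≤
      (orthPoly α N).eval t₀ ^ 2 + (orthPoly α (N + 1)).eval t₀ ^ 2 := by
  have := h.isFiniteMeasure
  have hpos : 0 < φ.real univ :=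
    ENNReal.toReal_pos (by simpa using h.ne_zero) (measure_ne_top _ _)
  set F := ∑ m ∈ Finset.range (N + 1), C ((orthPoly α m).eval t₀) * orthPoly α m with hF
  have hFint : ∫ t, F.eval t ^ 2 ∂φ = _ := h.integral_sum_sq (Finset.range (N + 1))
    fun m => (orthPoly α m).eval t₀
  -- By Christoffel–Darboux only two coefficients survive multiplication by `X - t₀`, while off the
  -- gap this factor has size at least `ε`.
  have hG : (X - C t₀) * F = ∑ m ∈ {N, N + 1}, C (if m = N then -(orthPoly α (N + 1)).eval t₀ else
      (orthPoly α N).eval t₀) * orthPoly α m := by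
    rw [hF, christoffel_darboux, Finset.sum_pair (by omega)]
    simp
    ring
  have hGint := h.integral_sum_sq {N, N + 1} fun m => if m = N then -(orthPoly α (N + 1)).eval t₀
    else (orthPoly α N).eval t₀
  rw [← hG, Finset.sum_pair (by omega)] at hGint
  have hsq : ∀ Q : ℝ[X], Integrable (fun t => Q.eval t ^ 2) φ := fun Q =>
    (h.integrable_eval (Q ^ 2)).congr (Filter.Eventually.of_forall fun t => Polynomial.eval_pow 2)
  have hle : ∫ t, ε ^ 2 * F.eval t ^ 2 ∂φ ≤ ∫ t, ((X - C t₀) * F).eval t ^ 2 ∂φ := by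
    refine integral_mono_ae ?_ ?_ ?_
    · exact (hsq F).const_mul _
    · exact hsq _
    · have hae : ∀ᵐ t ∂φ, t ∉ Ioo (t₀ - ε) (t₀ + ε) := measure_eq_zero_iff_ae_notMem.mp h0
      filter_upwards [hae] with t ht
      have : ε ≤ |t - t₀| := by
        by_contra! hlt
        rw [abs_lt] at hlt
        exact ht ⟨by linarith [hlt.1], by linarith [hlt.2]⟩
      have h2 : ε ^ 2 ≤ (t - t₀) ^ 2 := by
        rw [← sq_abs (t - t₀)]
        exact pow_le_pow_left₀ hε.le this 2
      simp only [eval_mul, eval_sub, eval_X, eval_C, mul_pow]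
      exact mul_le_mul_of_nonneg_right h2 (sq_nonneg _)
  rw [integral_const_mul, hFint, hGint] at hle
  simp at hle
  have : φ.real univ * (ε ^ 2 * ∑ m ∈ Finset.range (N + 1), (orthPoly α m).eval t₀ ^ 2) ≤
      φ.real univ * ((orthPoly α N).eval t₀ ^ 2 + (orthPoly α (N + 1)).eval t₀ ^ 2) := by
    linarith
  exact le_of_mul_le_mul_left this hpos

end IsOrthogonalityMeasure

/-- A conserved quadratic form of the recurrence; it is positive definite exactly when `|τ| < 2`. -/
theorem threeTerm_invariant {u : ℕ → ℝ} {τ : ℝ} (hu : ∀ n, u (n + 2) = τ * u (n + 1) - u n)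
    (n : ℕ) : u n ^ 2 + u (n + 1) ^ 2 - τ * u n * u (n + 1) =
      u 0 ^ 2 + u 1 ^ 2 - τ * u 0 * u 1 := by
  induction n with
  | zero => rfl
  | succ n ih => rw [← ih, hu]; ring

theorem threeTerm_bounds {u v τ : ℝ} :
    (1 - |τ| / 2) * (u ^ 2 + v ^ 2) ≤ u ^ 2 + v ^ 2 - τ * u * v ∧
      u ^ 2 + v ^ 2 - τ * u * v ≤ (1 + |τ| / 2) * (u ^ 2 + v ^ 2) := by
  have h1 : |u * v| ≤ (u ^ 2 + v ^ 2) / 2 := by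
    rw [abs_le]
    constructor <;> nlinarith [sq_nonneg (u + v), sq_nonneg (u - v)]
  have h2 : |τ * (u * v)| ≤ |τ| * ((u ^ 2 + v ^ 2) / 2) := by
    rw [abs_mul]
    exact mul_le_mul_of_nonneg_left h1 (abs_nonneg _)
  rw [abs_le] at h2
  constructor <;> nlinarith [h2.1, h2.2]

theorem mem_support_of_abs_lt_two {K : ℕ} (hK : 1 ≤ K) {α : ℕ → ℝ} (hα : ∀ m, α (m + K) = α m)
    {φ : Measure ℝ} (hφ : IsOrthogonalityMeasure (orthPoly α) φ) {t₀ : ℝ}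
    (ht : |(periodPoly α K).eval t₀| < 2) : t₀ ∈ φ.support := by
  by_contra hns
  obtain ⟨U, hU, hU0⟩ := Measure.notMem_support_iff_exists.mp hns
  obtain ⟨ε, hε, hεU⟩ := Metric.mem_nhds_iff.mp hU
  rw [Real.ball_eq_Ioo] at hεU
  have hsum := hφ.sum_sq_le hε (measure_mono_null hεU hU0)
  set τ := (periodPoly α K).eval t₀ with hτ
  set u : ℕ → ℝ := fun n => (shiftedOrthPoly α (n * K)).eval t₀ with hu
  set v : ℕ → ℝ := fun n => (shiftedOrthPoly α (n * K + 1)).eval t₀ with hv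
  have ru : ∀ n, u (n + 2) = τ * u (n + 1) - u n := by
    intro n
    have := congrArg (fun P => P.eval t₀) (shiftedOrthPoly_period hK hα n 0 (by norm_num))
    simpa using this
  have rv : ∀ n, v (n + 2) = τ * v (n + 1) - v n := by
    intro n
    have := congrArg (fun P => P.eval t₀) (shiftedOrthPoly_period hK hα n 1 (by norm_num))
    simpa using this
  have v0 : v 0 = 1 := by simp [hv, shiftedOrthPoly, orthPoly]
  set δ := 1 - |τ| / 2 with hδ
  have hδ0 : 0 < δ := by linarith
  set Eu := u 0 ^ 2 + u 1 ^ 2 - τ * u 0 * u 1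
  set Ev := v 0 ^ 2 + v 1 ^ 2 - τ * v 0 * v 1 with hEv
  have hEvpos : 0 < Ev := by
    have := (threeTerm_bounds (u := v 0) (v := v 1) (τ := τ)).1
    have h1 : 0 < v 0 ^ 2 + v 1 ^ 2 := by rw [v0]; positivity
    exact (mul_pos hδ0 h1).trans_le this
  have bu : ∀ n, δ * u n ^ 2 ≤ Eu := by
    intro n
    have h1 := (threeTerm_bounds (u := u n) (v := u (n + 1)) (τ := τ)).1
    rw [threeTerm_invariant ru] at h1
    nlinarith [mul_nonneg hδ0.le (sq_nonneg (u (n + 1)))]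
  have bv : ∀ n, δ * v n ^ 2 ≤ Ev := by
    intro n
    have h1 := (threeTerm_bounds (u := v n) (v := v (n + 1)) (τ := τ)).1
    rw [threeTerm_invariant rv] at h1
    nlinarith [mul_nonneg hδ0.le (sq_nonneg (v (n + 1)))]
  -- The upper constant `1 + |τ|/2` is less than 2, so two consecutive values cannot both be small.
  have lv : ∀ n, Ev / 2 ≤ v n ^ 2 + v (n + 1) ^ 2 := by
    intro n
    have h1 := (threeTerm_bounds (u := v n) (v := v (n + 1)) (τ := τ)).2
    rw [threeTerm_invariant rv] at h1
    nlinarith [sq_nonneg (v n), sq_nonneg (v (n + 1))]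
  have hvo : ∀ n, v n = (orthPoly α (n * K)).eval t₀ := fun n => rfl
  have huo : ∀ n, u (n + 1) = (orthPoly α ((n + 1) * K - 1)).eval t₀ := by
    intro n
    obtain ⟨k, hk⟩ := Nat.exists_eq_add_of_le'
      (Nat.le_trans hK (Nat.le_mul_of_pos_left K n.succ_pos))
    simp only [hu]
    rw [hk]
    rfl
  -- In the sum of consecutive pairs each `v i ^ 2` occurs at most twice, which turns `Ev / 2` into
  -- `Ev / 4`.
  have lower : ∀ n, n * (Ev / 4) ≤
      ∑ m ∈ Finset.range ((n + 1) * K), (orthPoly α m).eval t₀ ^ 2 := by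
    intro n
    have h1 : ∑ i ∈ Finset.range (n + 1), v i ^ 2 ≤
        ∑ m ∈ Finset.range ((n + 1) * K), (orthPoly α m).eval t₀ ^ 2 := by
      have hinj : InjOn (fun i => i * K) (Finset.range (n + 1)) := fun a _ b _ hab =>
        Nat.eq_of_mul_eq_mul_right hK hab
      refine (Finset.sum_image (f := fun m => (orthPoly α m).eval t₀ ^ 2) hinj).ge.trans ?_
      refine Finset.sum_le_sum_of_subset_of_nonneg ?_ fun _ _ _ => sq_nonneg _
      intro m hm
      simp only [Finset.mem_image, Finset.mem_range] at hm ⊢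
      obtain ⟨i, hi, rfl⟩ := hm
      exact Nat.mul_lt_mul_of_pos_right hi hK
    refine le_trans ?_ h1
    have h2 : (n : ℝ) * (Ev / 2) ≤ ∑ i ∈ Finset.range n, (v i ^ 2 + v (i + 1) ^ 2) := by
      have := Finset.card_nsmul_le_sum (Finset.range n) (fun i => v i ^ 2 + v (i + 1) ^ 2) (Ev / 2)
        fun i _ => lv i
      simpa using this
    rw [Finset.sum_add_distrib] at h2
    have h3 := Finset.sum_range_succ (fun i => v i ^ 2) n
    have h4 := Finset.sum_range_succ' (fun i => v i ^ 2) n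
    nlinarith [sq_nonneg (v n), sq_nonneg (v 0)]
  have upper : ∀ n : ℕ, ε ^ 2 * (n * (Ev / 4)) ≤ (Eu + Ev) / δ := by
    intro n
    -- With this cutoff the two boundary terms are `u (n + 1)` and `v (n + 1)`, both bounded,
    -- against a linearly growing sum.
    have h1 := hsum ((n + 1) * K - 1)
    have hk : (n + 1) * K - 1 + 1 = (n + 1) * K :=
      Nat.sub_add_cancel (Nat.le_trans hK (Nat.le_mul_of_pos_left K n.succ_pos))
    rw [hk, ← huo, ← hvo] at h1
    refine (mul_le_mul_of_nonneg_left (lower n) (sq_nonneg ε)).trans (h1.trans ?_)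
    rw [le_div_iff₀ hδ0]
    linarith [bu (n + 1), bv (n + 1)]
  obtain ⟨n, hn⟩ := exists_nat_gt ((Eu + Ev) / δ / (ε ^ 2 * (Ev / 4)))
  rw [div_lt_iff₀ (by positivity)] at hn
  linarith [upper n]

/-! ### The push-forward under `T / 2` -/

theorem map_periodPoly_div_two {K : ℕ} (hK : 1 ≤ K) {α : ℕ → ℝ} (hα : ∀ m, α (m + K) = α m)
    {φ : Measure ℝ} (hφ : IsOrthogonalityMeasure (orthPoly α) φ) :
    (φ.withDensity fun t => ENNReal.ofReal ((orthPoly α (K - 1)).eval t ^ 2)).map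
        (fun t => (periodPoly α K).eval t / 2) = φ univ • chebyshevMeasure := by
  have := hφ.isFiniteMeasure
  set q := orthPoly α (K - 1) with hq
  set T := periodPoly α K with hT
  set ψ := φ.withDensity fun t => ENNReal.ofReal (q.eval t ^ 2) with hψ
  have hqm : Measurable fun t => ENNReal.ofReal (q.eval t ^ 2) := by fun_prop
  have hTm : Measurable fun t => T.eval t / 2 := by fun_prop
  have hfin : IsFiniteMeasure ψ := by
    refine isFiniteMeasure_withDensity_ofReal ?_
    have := (hφ.integrable_eval (q ^ 2)).2
    simpa only [eval_pow] using this
  have hfin' : IsFiniteMeasure (φ univ • chebyshevMeasure) :=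
    Measure.smul_finite _ (measure_ne_top _ _)
  have hcomp : ∀ P : ℝ[X], ∀ t, P.eval (T.eval t / 2) = (P.comp (C 2⁻¹ * T)).eval t := by
    intro P t
    rw [eval_comp, eval_mul, eval_C, div_eq_inv_mul]
  have hint : ∀ P : ℝ[X], Integrable (fun x => P.eval x) (ψ.map fun t => T.eval t / 2) := by
    intro P
    rw [integrable_map_measure P.continuous.aestronglyMeasurable hTm.aemeasurable]
    rw [hψ, integrable_withDensity_iff hqm (by simp)]
    have := hφ.integrable_eval (P.comp (C 2⁻¹ * T) * q ^ 2)
    refine this.congr (Filter.Eventually.of_forall fun t => ?_)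
    simp only [Function.comp_apply]
    rw [ENNReal.toReal_ofReal (sq_nonneg _), hcomp, eval_mul, eval_pow]
  have hcs : (φ univ • chebyshevMeasure) (Icc (-1) 1)ᶜ = 0 := by
    simp [chebyshevMeasure_compl_Icc]
  have hint' : ∀ P : ℝ[X], Integrable (fun x => P.eval x) (φ univ • chebyshevMeasure) :=
    fun P => integrable_of_continuous_of_compl_Icc hcs P.continuous
  refine measure_eq_of_integral_eval_eq hint hint' hcs
    (integral_eval_eq_of_integral_chebyshev_U_eq hint hint' fun n => ?_)
  rw [integral_smul_measure, integral_chebyshev_U_chebyshevMeasure,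
    integral_map hTm.aemeasurable (Polynomial.continuous _).aestronglyMeasurable, hψ,
    integral_withDensity_eq_integral_toReal_smul hqm (by simp)]
  -- The identity `q_0² U_n(T/2) = q_n q_0` turns the `U_n`-moment into an orthogonality integral.
  have e : ∀ t, (ENNReal.ofReal (q.eval t ^ 2)).toReal •
      (Chebyshev.U ℝ n).eval (T.eval t / 2) =
      (orthPoly α ((n + 1) * K - 1)).eval t * (orthPoly α (K - 1)).eval t := by
    intro t
    rw [ENNReal.toReal_ofReal (sq_nonneg _), orthPoly_period_eq hK hα, ← hq, ← hT,
      ← Chebyshev.S_comp_two_mul_X]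
    simp [eval_comp]
    rw [mul_div_cancel₀ _ two_ne_zero]
    ring
  simp_rw [e]
  rw [hφ.integral_mul]
  have hiff : (n + 1) * K - 1 = K - 1 ↔ n = 0 := by
    constructor
    · intro h
      have h1 : (n + 1) * K = K := by
        have : K ≤ (n + 1) * K := Nat.le_mul_of_pos_left K n.succ_pos
        have h2 : (n + 1) * K - 1 = K - 1 := h
        omega
      have h2 : n * K = 0 := by linarith [Nat.succ_mul n K]
      exact (Nat.mul_eq_zero.mp h2).resolve_right (by omega)
    · rintro rfl; simp
  simp [hiff, Measure.real]

/-! ### Decomposition over the bands and conclusion -/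

theorem chebyshevMeasure_singleton (x : ℝ) : chebyshevMeasure {x} = 0 :=
  withDensity_absolutelyContinuous _ _
    (Measure.absolutelyContinuous_of_le Measure.restrict_le_self (by simp))

/-- Neighbouring bands may share an endpoint, so their disjointness holds only up to points, which
carry no mass. -/
theorem sum_restrict_Icc_eq {ψ : Measure ℝ} (hψ : ∀ x, ψ {x} = 0) {r : ℕ} {c d : Fin r → ℝ}
    (hcd : ∀ k l, k < l → d k ≤ c l) (hnull : ψ (⋃ l, Icc (c l) (d l))ᶜ = 0) :
    ∑ l, ψ.restrict (Icc (c l) (d l)) = ψ := by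
  have hd : Pairwise (Function.onFun (AEDisjoint ψ) fun l => Icc (c l) (d l)) := by
    have key : ∀ k l, k < l → AEDisjoint ψ (Icc (c k) (d k)) (Icc (c l) (d l)) := by
      intro k l hkl
      refine measure_mono_null (t := {d k}) (fun x hx => ?_) (hψ _)
      exact le_antisymm hx.1.2 ((hcd k l hkl).trans hx.2.1)
    intro k l hkl
    rcases lt_or_gt_of_ne hkl with h | h
    · exact key k l h
    · exact (key l k h).symm
  have h1 := Measure.restrict_iUnion_ae hd fun l => measurableSet_Icc.nullMeasurableSet (μ := ψ)
  rw [Measure.sum_fintype] at h1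
  rw [← h1]
  exact Measure.restrict_eq_self_of_ae_mem hnull

theorem essentialSupport_eq {φ : Measure ℝ} {Ξ Z : Set ℝ} (hΞ : IsClosed Ξ) (hZ : Z.Finite)
    (h0 : φ {t | t ∉ Ξ ∧ t ∉ Z} = 0) (hsup : Ξ ⊆ closure (interior φ.support)) :
    essentialSupport φ = Ξ := by
  ext t
  constructor
  · intro ht
    by_contra htΞ
    refine ht Ξᶜ (hΞ.isOpen_compl.mem_nhds htΞ) (hZ.subset ?_)
    rintro x ⟨hx, hxs⟩
    by_contra hxZ
    have hopen : IsOpen {t | t ∉ Ξ ∧ t ∉ Z} := hΞ.isOpen_compl.inter hZ.isClosed.isOpen_compl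
    exact Measure.subset_compl_support_of_isOpen hopen h0 ⟨hx, hxZ⟩ hxs
  · intro ht U hU
    obtain ⟨V, hVU, hV, htV⟩ := mem_nhds_iff.mp hU
    obtain ⟨x, hxV, hxs⟩ := mem_closure_iff.mp (hsup ht) V hV htV
    refine (infinite_of_mem_nhds x ((hV.inter isOpen_interior).mem_nhds ⟨hxV, hxs⟩)).mono ?_
    exact inter_subset_inter hVU interior_subset

theorem theorem2 (K : ℕ) (hK : 1 ≤ K) (α : ℕ → ℝ) (hα : ∀ m, α (m + K) = α m)
    (φ : Measure ℝ) (hφ : IsOrthogonalityMeasure (orthPoly α) φ) :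
    -- the turning points of `T`, with `-∞` and `∞` added, cut the line into monotonicity intervals
    ∃ (s : ℕ) (ξ : Fin (s + 2) → EReal),
      IsTurningSequence (periodPoly α K) s ξ ∧
      (∀ j : Fin (s + 1),
        StrictMonoOn (fun t => (periodPoly α K).eval t) (turningInterval ξ j) ∨
        StrictAntiOn (fun t => (periodPoly α K).eval t) (turningInterval ξ j)) ∧
      -- `ν` lists the monotonicity intervals on which `T` takes all values in `[-2, 2]`, and
      -- `[c l, d l]` is the part of the `l`-th one that ends at the points where `|T| = 2`
      ∃ (r : ℕ) (ν : Fin r → Fin (s + 1)) (c d : Fin r → ℝ) (Ξ : Set ℝ),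
        StrictMono ν ∧
        (∀ j : Fin (s + 1), j ∈ range ν ↔
          Icc (-2) 2 ⊆ (fun t => (periodPoly α K).eval t) '' turningInterval ξ j) ∧
        (∀ l : Fin r, IsUniqueBand (periodPoly α K) (turningInterval ξ (ν l)) (c l) (d l)) ∧
        Pairwise (fun k l : Fin r => Disjoint (Ioo (c k) (d k)) (Ioo (c l) (d l))) ∧
        Ξ = ⋃ l : Fin r, Icc (c l) (d l) ∧
        -- `Ξ` is the essential support, and outside `Ξ` there are at most point masses at the
        -- zeros of `q_0`
        essentialSupport φ = Ξ ∧
        φ {t | t ∉ Ξ ∧ (orthPoly α (K - 1)).eval t ≠ 0} = 0 ∧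
        -- the measure `ψ = q_0 ^ 2 φ` lives on `Ξ`, and its images under `T / 2` from the
        -- intervals `[c l, d l]` add up to a multiple of the Chebyshev measure
        ∃ ψ : Measure ℝ,
          ψ = φ.withDensity
            (fun t => ENNReal.ofReal ((orthPoly α (K - 1)).eval t ^ 2)) ∧
          ψ Ξᶜ = 0 ∧
          ∑ l : Fin r, (ψ.restrict (Icc (c l) (d l))).map
              (fun t => (periodPoly α K).eval t / 2) =
            φ univ • chebyshevMeasure := by
  have hdeg : 0 < (periodPoly α K).natDegree := by rw [periodPoly_natDegree]; omega
  obtain ⟨s, ξ, hξ⟩ := exists_isTurningSequence hdeg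
  have hband := fun j => hξ.exists_isBand hdeg (fun x hx => periodPoly_isLocalMax hK hα hx)
    (fun x hx => periodPoly_isLocalMin hK hα hx) j
  choose himg c d hb using hband
  have hΞ := hξ.iUnion_Icc_eq hb
  have hcd : ∀ k l, k < l → d k ≤ c l := fun k l hkl => hξ.right_le_left hb hkl
  have hmap := map_periodPoly_div_two hK hα hφ
  set T := periodPoly α K with hT
  set q := orthPoly α (K - 1) with hq
  set ψ := φ.withDensity fun t => ENNReal.ofReal (q.eval t ^ 2) with hψ
  have hTm : Measurable fun t => T.eval t / 2 := by fun_prop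
  have hqm : Measurable fun t => ENNReal.ofReal (q.eval t ^ 2) := by fun_prop
  have hψΞ : ψ (⋃ l, Icc (c l) (d l))ᶜ = 0 := by
    have h1 : ψ.map (fun t => T.eval t / 2) (Icc (-1) 1)ᶜ = 0 := by
      rw [hmap]; simp [chebyshevMeasure_compl_Icc]
    rw [Measure.map_apply hTm measurableSet_Icc.compl] at h1
    rw [hΞ]
    refine measure_mono_null (fun t ht => ?_) h1
    rintro hmem
    refine ht ?_
    show |T.eval t| ≤ 2
    rw [abs_le]
    constructor <;> linarith [hmem.1, hmem.2]
  -- An atom of `ψ` at `x` would push forward to an atom of the Chebyshev measure.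
  have hψatom : ∀ x, ψ {x} = 0 := by
    intro x
    have h1 : ψ.map (fun t => T.eval t / 2) {T.eval x / 2} = 0 := by
      rw [hmap]; simp [chebyshevMeasure_singleton]
    rw [Measure.map_apply hTm (measurableSet_singleton _)] at h1
    exact measure_mono_null (by rintro _ rfl; rfl) h1
  have hφ0 : φ {t | t ∉ ⋃ l, Icc (c l) (d l) ∧ q.eval t ≠ 0} = 0 := by
    rw [hψ, withDensity_apply_eq_zero hqm] at hψΞ
    refine measure_mono_null (fun t ht => ?_) hψΞ
    have h2 : 0 < q.eval t ^ 2 := by have := ht.2; positivity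
    exact ⟨by simpa using h2.not_ge, ht.1⟩
  have hqne : q ≠ 0 := (orthPoly_monic_natDegree α (K - 1)).1.ne_zero
  have hess : essentialSupport φ = ⋃ l, Icc (c l) (d l) := by
    refine essentialSupport_eq (Z := {t | q.eval t = 0})
      (isClosed_iUnion_of_finite fun l => isClosed_Icc)
      (q.roots.toFinset.finite_toSet.subset fun t ht => ?_) hφ0 ?_
    · have : q.eval t = 0 := ht
      simp [hqne, this]
    · refine iUnion_subset fun l => ?_
      rw [← closure_Ioo (hb l).lt.ne]
      refine closure_mono (interior_maximal (fun t ht => ?_) isOpen_Ioo)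
      exact mem_support_of_abs_lt_two hK hα hφ (hξ.abs_eval_lt_two (hb l) ht)
  -- Every monotonicity interval carries a band, so `r = s + 1` and `ν` is the identity.
  refine ⟨s, ξ, hξ, hξ.strictMonoOn_or_strictAntiOn, s + 1, id, c, d, _, strictMono_id,
    fun j => ⟨fun _ => himg j, fun _ => ⟨j, rfl⟩⟩, fun l => hξ.isUniqueBand (hb l), ?_, rfl,
    hess, hφ0, ψ, rfl, hψΞ, ?_⟩
  · have key : ∀ k l, k < l → Disjoint (Ioo (c k) (d k)) (Ioo (c l) (d l)) := by
      intro k l hkl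
      rw [Set.disjoint_left]
      intro t h1 h2
      linarith [hcd k l hkl, h1.2, h2.1]
    intro k l hkl
    rcases lt_or_gt_of_ne hkl with h | h
    · exact key k l h
    · exact (key l k h).symm
  · rw [← hmap]
    conv_rhs => rw [← sum_restrict_Icc_eq hψatom hcd hψΞ]
    rw [← Measure.mapₗ_apply_of_measurable hTm, map_sum]
    simp [Measure.mapₗ_apply_of_measurable hTm]
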